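/- Consider the discrete-time $\mathcal N$-system: two queues (job types 1 and 2) and two servers, where server 1 can process only type 1 jobs, server 2 can process both types, and each server processes one job per time slot. In each slot each server idles or is assigned to one queue that it can serve, and the service vector $s\in\mathbb Z_+^2$ counts the servers assigned to each queue. Let $\mathcal S$ be the set of feasible service vectors under either one of two conventions: both servers may work on queue 1 in the same slot, so that $\mathcal S=\{(0,0),(1,0),(0,1),(1,1),(2,0)\}$; or each queue is served by at most one server per slot, so that $\mathcal S=\{0,1\}^2$. For each $\epsilon\in(0,1)$ let the arrival vectors $a^{(\epsilon)}(k)\in\mathbb Z_+^2$, $k\ge 0$, be i.i.d. (the two coordinates may be dependent), bounded by a constant $A_{\max}$ that does not depend on $\epsilon$, with $E[a^{(\epsilon)}(k)]=(1-\epsilon)(1,1)$, and suppose that $\mathrm{Var}(a^{(\epsilon)}_i(k))\to\sigma_{a_i}^2$ as $\epsilon\downarrow 0$ for $i=1,2$. The queue lengths evolve by $$q_i^{(\epsilon)}(k+1)=\max\{q_i^{(\epsilon)}(k)+a_i^{(\epsilon)}(k)-s_i^{(\epsilon)}(k),\,0\},\qquad i=1,2,$$ where $s^{(\epsilon)}(k)$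 is chosen by MaxWeight, that is, $s^{(\epsilon)}(k)\in\arg\max_{x\in\mathcal S}\langle q^{(\epsilon)}(k),x\rangle$, with ties broken at random by any law that depends only on the current queue lengths, before the arrivals $a^{(\epsilon)}(k)$ and independently of them. Then for every $\epsilon\in(0,1)$ the Markov chain $q^{(\epsilon)}$ has a steady state (a limit in distribution of $q^{(\epsilon)}(k)$ as $k\to\infty$ from some initial law). If $\overline q^{(\epsilon)}$ is distributed as any such steady state, for each $\epsilon\in(0,1)$, then $E[\overline q_1^{(\epsilon)}+\overline q_2^{(\epsilon)}]<\infty$ for every $\epsilon\in(0,1)$ and $$\lim_{\epsilon\downarrow 0}\epsilon\,E\left[\overline q_1^{(\epsilon)}+\overline q_2^{(\epsilon)}\right]=\frac{\sigma_{a_1}^2+\sigma_{a_2}^2}{2}.$$ -/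

import Mathlib

open Set Filter Topology MeasureTheory ProbabilityTheory

/-- Queue-length, arrival and service vectors of a system with two queues; coordinate `0` is the
queue of type 1 jobs and coordinate `1` is the queue of type 2 jobs. -/
abbrev Vec2 : Type := Fin 2 → ℕ

namespace NSystem

/-- The compatibility graph of the N-system: server `0` can only work on queue `0`,
server `1` can work on both queues. -/
def Compatible (server queue : Fin 2) : Prop :=
  queue = 0 ∨ server = 1

/-- `f` tells, for each server, the queue on which it works in a time slot (`none`: it idles). -/
def IsAssignment (f : Fin 2 → Option (Fin 2)) : Prop :=
  ∀ server queue, f server = some queue → Compatible server queue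

/-- The potential service offered to each queue under the assignment `f`, when every server
processes one job per time slot: the number of servers which work on the queue. -/
def service (f : Fin 2 → Option (Fin 2)) : Vec2 :=
  fun queue => (Finset.univ.filter fun server => f server = some queue).card

/-- The feasible service vectors when both servers may work on the same queue in a time slot. -/
def pooledSchedules : Set Vec2 :=
  {x | ∃ f, IsAssignment f ∧ x = service f}

/-- The feasible service vectors when at most one server works on each queue in a time slot. -/
def singleSchedules : Set Vec2 :=
  {x | ∃ f, IsAssignment f ∧ (∀ queue, service f queue ≤ 1) ∧ x = service f}

/-- A scheduling rule chooses, at random, a service vector as a function of the current queue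
lengths. It is MaxWeight for the feasible set `S` if it always picks a vector of `S` which
maximizes `⟨q, x⟩` over `S`; among several maximizers the choice is random, with any law. -/
def IsMaxWeight (S : Set Vec2) (rule : Vec2 → PMF Vec2) : Prop :=
  ∀ q, ∀ s ∈ (rule q).support,
    s ∈ S ∧ ∀ x ∈ S, ∑ i, q i * x i ≤ ∑ i, q i * s i

/-- Unused service: the part of the potential service `s` that exceeds the number of jobs
available, namely those in line (`q`) and those that have just arrived (`a`). -/
def unused (q a s : Vec2) : Vec2 :=
  fun i => s i - (q i + a i)

/-- Queue lengths in the next time slot, `q + a - s + u`. -/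
def next (q a s : Vec2) : Vec2 :=
  fun i => q i + a i + unused q a s i - s i

/-- One step of the Markov chain of queue lengths: a schedule is drawn from `rule q`, the vector
of arrivals is drawn from `arr` independently of it and of the past, then jobs are served. -/
noncomputable def step (arr : PMF Vec2) (rule : Vec2 → PMF Vec2) (q : Vec2) : PMF Vec2 :=
  (rule q).bind fun s => arr.map fun a => next q a s

/-- The law of the state at time `k` of the Markov chain with transition probabilities `P` and
initial law `init`. -/
noncomputable def law (P : Vec2 → PMF Vec2) (init : PMF Vec2) : ℕ → PMF Vec2
  | 0 => init
  | k + 1 => (law P init k).bind P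

/-- The probability measure of a probability mass function. -/
noncomputable def toProb (p : PMF Vec2) : ProbabilityMeasure Vec2 :=
  ⟨p.toMeasure, inferInstance⟩

/-- `π` is the law of a steady-state vector of the Markov chain with transition probabilities `P`:
the chain, started from some initial law, converges in distribution to `π`. (Every stationary
law is such a limit: start the chain from it.) -/
def IsSteadyState (P : Vec2 → PMF Vec2) (π : PMF Vec2) : Prop :=
  ∃ init : PMF Vec2, Tendsto (fun k => toProb (law P init k)) atTop (𝓝 (toProb π))

end NSystem

/-! The test function is `q₀² + q₁²`, whose mean increment vanishes in steady state. A queue with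
unused service `u` ends the slot empty, so the increment has an exact form; comparing the schedule
`s` with `(1,1)` turns it into `2⟨q, a - 1⟩ - 2 weightGain + |a - 1|² + remainder`
(`sqNorm_nextState_sub_eq`). As `a` is independent of `q`, taking means gives `2ε E[q₀ + q₁] = Var
a₀ + Var a₁ + 2ε² - 2 E weightGain + E remainder`, and the last two means must be shown to be
`O(ε)`.

The remainder vanishes when `s = (1,1)` and no service is unused. Deviations from this are rare,
because `E sᵢ = 1 - ε + E uᵢ` while `s₁ ≤ 1` and `s₀ + s₁ ≤ 2`. The gain is zero if each queue gets
at most one server. With pooling, `(1,1)` is a vertex of the capacity region with normal cone `q₀ ≤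
q₁`, and the gain is at most the distance-like excess `(q₀ - q₁)⁺`. A positive excess draws both
servers to queue 0 and so drifts down; since queue 1 can go unserved in at most a fraction `ε` of
the slots, the mean excess is `O(ε)` (`integral_excess_le`).

Steady states are the same as stationary laws. Second moments are not known to be finite, so the
zero mean increment is obtained by clamping (`integral_nextState_sub`). The crude drift bound
`-2ε(q₀ + q₁) + const` gives finite means by truncation, and existence by tightness of time
averages. -/

namespace NSystem

/-! ### The joint law of queue lengths, schedule and arrivals in one slot -/

/-- The joint law of `((q, s), a)` when `q` has law `p`, `s` is drawn from `rule q` and `a` is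
drawn independently from `arr`. -/
noncomputable def slotPMF (p arr : PMF Vec2) (rule : Vec2 → PMF Vec2) :
    PMF ((Vec2 × Vec2) × Vec2) :=
  (p.bind fun q => (rule q).map (Prod.mk q)).bind fun x => arr.map (Prod.mk x)

/-- The probability measure of `slotPMF`. -/
noncomputable def slotLaw (p arr : PMF Vec2) (rule : Vec2 → PMF Vec2) :
    Measure ((Vec2 × Vec2) × Vec2) :=
  (slotPMF p arr rule).toMeasure

instance (p arr : PMF Vec2) (rule : Vec2 → PMF Vec2) :
    IsProbabilityMeasure (slotLaw p arr rule) :=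
  inferInstanceAs (IsProbabilityMeasure (slotPMF p arr rule).toMeasure)

/-- The queue lengths after the slot described by `ω`. -/
def nextState (ω : (Vec2 × Vec2) × Vec2) : Vec2 := next ω.1.1 ω.2 ω.1.2

theorem toMeasure_bind_map_mk {α β : Type*} [Countable α] [Countable β] [MeasurableSpace α]
    [MeasurableSpace β] [MeasurableSingletonClass α] [MeasurableSingletonClass β]
    (p : PMF α) (r : PMF β) :
    (p.bind fun x => r.map (Prod.mk x)).toMeasure = p.toMeasure.prod r.toMeasure := by
  classical
  refine Measure.ext_of_singleton fun ⟨x, y⟩ => ?_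
  rw [PMF.toMeasure_apply_singleton _ _ (measurableSet_singleton _), ← singleton_prod_singleton,
    Measure.prod_prod, PMF.toMeasure_apply_singleton _ _ (measurableSet_singleton _),
    PMF.toMeasure_apply_singleton _ _ (measurableSet_singleton _), PMF.bind_apply,
    tsum_eq_single x]
  · rw [PMF.map_apply, tsum_eq_single y]
    · simp
    · intro b hb
      simp [hb.symm]
  · intro x' hx'
    rw [PMF.map_apply]
    simp [hx'.symm]

section SlotLaw

variable {p arr : PMF Vec2} {rule : Vec2 → PMF Vec2}

theorem slotLaw_eq_prod : slotLaw p arr rule =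
    (p.bind fun q => (rule q).map (Prod.mk q)).toMeasure.prod arr.toMeasure :=
  toMeasure_bind_map_mk _ _

theorem map_fun_const (r : PMF Vec2) (b : Vec2) : r.map (fun _ => b) = PMF.pure b :=
  PMF.map_const r b

theorem map_queue_toMeasure :
    (p.bind fun q => (rule q).map (Prod.mk q)).toMeasure.map Prod.fst = p.toMeasure := by
  rw [PMF.toMeasure_map _ _ .of_discrete, PMF.map_bind]
  simp [PMF.map_comp, Function.comp_def, map_fun_const]

theorem map_queue_slotLaw : (slotLaw p arr rule).map (fun ω => ω.1.1) = p.toMeasure := by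
  rw [slotLaw, PMF.toMeasure_map _ _ .of_discrete, slotPMF]
  simp [PMF.map_bind, PMF.map_comp, Function.comp_def, map_fun_const]

theorem map_nextState_slotLaw :
    (slotLaw p arr rule).map nextState = (p.bind (step arr rule)).toMeasure := by
  rw [slotLaw, PMF.toMeasure_map _ _ .of_discrete, slotPMF]
  simp only [PMF.map_bind, PMF.bind_bind, PMF.bind_map, Function.comp_def, PMF.map_comp]
  rfl

theorem map_arrival_slotLaw : (slotLaw p arr rule).map (fun ω => ω.2) = arr.toMeasure := by
  rw [slotLaw_eq_prod]
  simp [Measure.map_snd_prod]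

theorem ae_slotLaw : ∀ᵐ ω ∂slotLaw p arr rule,
    ω.1.1 ∈ p.support ∧ ω.1.2 ∈ (rule ω.1.1).support ∧ ω.2 ∈ arr.support := by
  rw [ae_iff, slotLaw, PMF.toMeasure_apply_eq_zero_iff _ (.of_discrete), Set.disjoint_left]
  rintro ⟨⟨q, s⟩, a⟩ h
  simp only [slotPMF, PMF.mem_support_bind_iff, PMF.mem_support_map_iff] at h
  obtain ⟨x, ⟨q', hq', s', hs', rfl⟩, a', ha', h⟩ := h
  simp only [Prod.mk.injEq] at h
  obtain ⟨⟨rfl, rfl⟩, rfl⟩ := h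
  simp only [mem_ofPred_eq, not_not]
  exact ⟨hq', hs', ha'⟩

theorem integral_queue (g : Vec2 → ℝ) :
    ∫ ω, g ω.1.1 ∂slotLaw p arr rule = ∫ q, g q ∂p.toMeasure := by
  rw [← map_queue_slotLaw (arr := arr) (rule := rule), integral_map
    Measurable.of_discrete.aemeasurable .of_discrete]

theorem integrable_queue {g : Vec2 → ℝ} (hg : Integrable g p.toMeasure) :
    Integrable (fun ω => g ω.1.1) (slotLaw p arr rule) := by
  rw [← map_queue_slotLaw (arr := arr) (rule := rule)] at hg
  exact hg.comp_measurable .of_discrete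

theorem integral_nextState (g : Vec2 → ℝ) :
    ∫ ω, g (nextState ω) ∂slotLaw p arr rule = ∫ q, g q ∂(p.bind (step arr rule)).toMeasure := by
  rw [← map_nextState_slotLaw, integral_map Measurable.of_discrete.aemeasurable .of_discrete]

theorem integral_arrival (g : Vec2 → ℝ) :
    ∫ ω, g ω.2 ∂slotLaw p arr rule = ∫ a, g a ∂arr.toMeasure := by
  rw [← map_arrival_slotLaw (p := p) (rule := rule), integral_map
    Measurable.of_discrete.aemeasurable .of_discrete]

theorem integral_queue_mul_arrival (g h : Vec2 → ℝ) :
    ∫ ω, g ω.1.1 * h ω.2 ∂slotLaw p arr rule =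
      (∫ q, g q ∂p.toMeasure) * ∫ a, h a ∂arr.toMeasure := by
  rw [slotLaw_eq_prod, integral_prod_mul (fun x : Vec2 × Vec2 => g x.1) h,
    ← map_queue_toMeasure (p := p) (rule := rule),
    integral_map Measurable.of_discrete.aemeasurable .of_discrete]

theorem integrable_queue_mul_arrival {g h : Vec2 → ℝ} (hg : Integrable g p.toMeasure)
    (hh : Integrable h arr.toMeasure) :
    Integrable (fun ω => g ω.1.1 * h ω.2) (slotLaw p arr rule) := by
  rw [slotLaw_eq_prod]
  rw [← map_queue_toMeasure (p := p) (rule := rule)] at hg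
  exact (hg.comp_measurable .of_discrete).mul_prod hh

theorem integrable_of_ae_bound {μ : Measure ((Vec2 × Vec2) × Vec2)} [IsFiniteMeasure μ]
    {f : (Vec2 × Vec2) × Vec2 → ℝ} (C : ℝ) (h : ∀ᵐ ω ∂μ, |f ω| ≤ C) : Integrable f μ :=
  .of_bound .of_discrete C h

/-! ### Stationary laws -/

/-- Under a stationary law, the increments of any function have mean zero as soon as they are
integrable, even if the function itself is not. -/
theorem integral_nextState_sub (hp : p.bind (step arr rule) = p) (V : Vec2 → ℝ)
    (hV : Integrable (fun ω => V (nextState ω) - V ω.1.1) (slotLaw p arr rule)) :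
    ∫ ω, (V (nextState ω) - V ω.1.1) ∂slotLaw p arr rule = 0 := by
  -- Clamping to `[-n, n]` is bounded and 1-Lipschitz: the clamped increments have mean zero and are
  -- dominated by the true ones.
  let c : ℕ → ℝ → ℝ := fun n x => max (-n) (min n x)
  have hc : ∀ n x, |c n x| ≤ n := fun n x => by
    rw [abs_le]
    exact ⟨le_max_left _ _, max_le (by linarith [(Nat.cast_nonneg n : (0 : ℝ) ≤ n)])
      (min_le_left _ _)⟩
  have hlip : ∀ n x y, |c n x - c n y| ≤ |x - y| := fun n x y => by
    refine (abs_max_sub_max_le_max _ _ _ _).trans ?_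
    rw [sub_self, abs_zero, max_eq_right (abs_nonneg _)]
    refine (abs_min_sub_min_le_max _ _ _ _).trans ?_
    rw [sub_self, abs_zero, max_eq_right (abs_nonneg _)]
  have hlim : ∀ x, Tendsto (fun n => c n x) atTop (𝓝 x) := fun x => by
    obtain ⟨N, hN⟩ := exists_nat_ge |x|
    refine tendsto_const_nhds.congr' ?_
    filter_upwards [eventually_ge_atTop N] with n hn
    have : |x| ≤ n := hN.trans (by exact_mod_cast hn)
    rw [abs_le] at this
    simp only [c]
    rw [min_eq_right this.2, max_eq_right this.1]
  have key : Tendsto (fun n => ∫ ω, (c n (V (nextState ω)) - c n (V ω.1.1)) ∂slotLaw p arr rule)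
      atTop (𝓝 (∫ ω, (V (nextState ω) - V ω.1.1) ∂slotLaw p arr rule)) :=
    tendsto_integral_of_dominated_convergence (fun ω => |V (nextState ω) - V ω.1.1|)
      (fun n => .of_discrete) hV.abs (fun n => ae_of_all _ fun ω => hlip n _ _)
      (ae_of_all _ fun ω => (hlim _).sub (hlim _))
  have hz : ∀ n, ∫ ω, (c n (V (nextState ω)) - c n (V ω.1.1)) ∂slotLaw p arr rule = 0 := fun n => by
    rw [integral_sub (integrable_of_ae_bound n (ae_of_all _ fun ω => hc n _))
      (integrable_of_ae_bound n (ae_of_all _ fun ω => hc n _)),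
      integral_nextState (fun q => c n (V q)), hp, integral_queue (fun q => c n (V q)), sub_self]
  simp only [hz] at key
  exact (tendsto_nhds_unique key tendsto_const_nhds)

/-- Both masses sum to one, so a strict inequality anywhere would survive summation. Invariance thus
needs only one inequality. -/
theorem pmf_eq_of_le {α : Type*} {p r : PMF α} (h : ∀ x, p x ≤ r x) : p = r := by
  by_contra hne
  obtain ⟨x, hx⟩ : ∃ x, p x ≠ r x := by
    by_contra! hall
    exact hne (PMF.ext hall)
  have := ENNReal.tsum_lt_tsum (by simp [p.tsum_coe]) h (lt_of_le_of_ne (h x) hx)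
  simp [p.tsum_coe, r.tsum_coe] at this

/-- A pointwise limit of sub-probability vectors that are almost invariant is invariant. -/
theorem bind_eq_of_tendsto {α ι : Type*} {l : Filter ι} [l.NeBot] {π : PMF α} {P : α → PMF α}
    {m m' : ι → α → ENNReal} (hm : ∀ x, Tendsto (fun i => m i x) l (𝓝 (π x)))
    (hm' : ∀ x, Tendsto (fun i => m' i x) l (𝓝 (π x)))
    (hle : ∀ i y, ∑' x, m i x * P x y ≤ m' i y) : π.bind P = π := by
  refine pmf_eq_of_le fun y => ?_
  rw [PMF.bind_apply, ENNReal.tsum_eq_iSup_sum]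
  refine iSup_le fun F => ?_
  refine le_of_tendsto_of_tendsto (f := fun i => ∑ x ∈ F, m i x * P x y)
    (tendsto_finsetSum F fun x _ =>
    ENNReal.Tendsto.mul_const (hm x) (.inr ((P x).apply_ne_top y))) (hm' y) ?_
  exact Eventually.of_forall fun i => (ENNReal.sum_le_tsum F).trans (hle i y)

/-- Singletons of a discrete space have empty frontier, so convergence in distribution gives
convergence of each point mass, also after a time shift. -/
theorem IsSteadyState.bind_eq {P : Vec2 → PMF Vec2} {π : PMF Vec2} (h : IsSteadyState P π) :
    π.bind P = π := by
  obtain ⟨init, h⟩ := h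
  have hpt : ∀ x, Tendsto (fun k => law P init k x) atTop (𝓝 (π x)) := fun x => by
    have := ProbabilityMeasure.tendsto_measure_of_null_frontier_of_tendsto' h (E := {x})
      (by simp)
    simpa [toProb, PMF.toMeasure_apply_singleton] using this
  refine bind_eq_of_tendsto hpt (fun x => (tendsto_add_atTop_iff_nat 1).2 (hpt x)) fun k y => ?_
  rw [law, PMF.bind_apply]

theorem isSteadyState_of_bind_eq {P : Vec2 → PMF Vec2} {π : PMF Vec2} (h : π.bind P = π) :
    IsSteadyState P π := by
  refine ⟨π, ?_⟩
  have : ∀ k, law P π k = π := fun k => by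
    induction k with
    | zero => rfl
    | succ k ih => rw [law, ih, h]
  simp only [this]
  exact tendsto_const_nhds

end SlotLaw

/-! ### Feasible schedules and MaxWeight -/

theorem service_le_of_isAssignment {f : Fin 2 → Option (Fin 2)} (hf : IsAssignment f) :
    service f 1 ≤ 1 ∧ service f 0 + service f 1 ≤ 2 := by
  revert f
  unfold IsAssignment Compatible service
  decide

theorem le_of_mem_schedules {S : Set Vec2} (hS : S = pooledSchedules ∨ S = singleSchedules)
    {s : Vec2} (hs : s ∈ S) : s 1 ≤ 1 ∧ s 0 + s 1 ≤ 2 := by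
  rcases hS with rfl | rfl
  · obtain ⟨f, hf, rfl⟩ := hs
    exact service_le_of_isAssignment hf
  · obtain ⟨f, hf, -, rfl⟩ := hs
    exact service_le_of_isAssignment hf

theorem le_one_of_mem_singleSchedules {s : Vec2} (hs : s ∈ singleSchedules) (i : Fin 2) :
    s i ≤ 1 := by
  obtain ⟨f, -, hf, rfl⟩ := hs
  exact hf i

theorem service_one_each : service (fun j => some j) = fun _ => 1 := by
  unfold service
  decide

/-- This is the competitor that gives MaxWeight a weight of at least `q₀ + q₁`. -/
theorem one_each_mem {S : Set Vec2} (hS : S = pooledSchedules ∨ S = singleSchedules) :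
    (fun _ => 1 : Vec2) ∈ S := by
  have h : IsAssignment (fun j => some j) := by
    unfold IsAssignment Compatible
    decide
  rcases hS with rfl | rfl
  · exact ⟨_, h, service_one_each.symm⟩
  · exact ⟨_, h, fun i => by rw [service_one_each], service_one_each.symm⟩

theorem two_zero_mem : (![2, 0] : Vec2) ∈ pooledSchedules := by
  refine ⟨fun _ => some 0, ?_, ?_⟩
  · unfold IsAssignment Compatible
    decide
  · unfold service
    decide

section Dynamics

variable {S : Set Vec2} {p arr : PMF Vec2} {rule : Vec2 → PMF Vec2} {A : ℕ}

/-- What is known about every slot, under either convention: `ω = ((q, s), a)`. -/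
structure IsSlot (A : ℕ) (ω : (Vec2 × Vec2) × Vec2) : Prop where
  arrival_le : ∀ i, ω.2 i ≤ A
  service_one_le : ω.1.2 1 ≤ 1
  service_add_le : ω.1.2 0 + ω.1.2 1 ≤ 2
  weight_le : ω.1.1 0 + ω.1.1 1 ≤ ω.1.1 0 * ω.1.2 0 + ω.1.1 1 * ω.1.2 1

theorem ae_isSlot (hS : S = pooledSchedules ∨ S = singleSchedules) (hMW : IsMaxWeight S rule)
    (hA : ∀ a ∈ arr.support, ∀ i, a i ≤ A) : ∀ᵐ ω ∂slotLaw p arr rule, IsSlot A ω := by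
  filter_upwards [ae_slotLaw] with ω ⟨_, hs, ha⟩
  obtain ⟨hsS, hmax⟩ := hMW _ _ hs
  have h := hmax _ (one_each_mem hS)
  simp only [Fin.sum_univ_two, mul_one] at h
  exact ⟨hA _ ha, (le_of_mem_schedules hS hsS).1, (le_of_mem_schedules hS hsS).2, h⟩

/-- Combined with `IsSlot.weight_le`, this forces `weightGain` to vanish. -/
theorem ae_weight_le_of_single (hMW : IsMaxWeight singleSchedules rule) :
    ∀ᵐ ω ∂slotLaw p arr rule,
      ω.1.1 0 * ω.1.2 0 + ω.1.1 1 * ω.1.2 1 ≤ ω.1.1 0 + ω.1.1 1 := by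
  filter_upwards [ae_slotLaw] with ω ⟨_, hs, _⟩
  have h := le_one_of_mem_singleSchedules (hMW _ _ hs).1
  exact add_le_add (mul_le_of_le_one_right' (h 0)) (mul_le_of_le_one_right' (h 1))

/-- As `x + y ≤ 2`, the weight `q₀ x + q₁ y` is at most `2 q₀ - y (q₀ - q₁)`, so `(2,0)` is the only
maximizer and ties play no role. -/
theorem ae_service_of_pooled (hMW : IsMaxWeight pooledSchedules rule) :
    ∀ᵐ ω ∂slotLaw p arr rule, ω.1.1 1 < ω.1.1 0 → ω.1.2 0 = 2 ∧ ω.1.2 1 = 0 := by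
  filter_upwards [ae_slotLaw] with ω ⟨_, hs, _⟩ hlt
  obtain ⟨hsS, hmax⟩ := hMW _ _ hs
  have h := hmax _ two_zero_mem
  have h2 := le_of_mem_schedules (.inl rfl) hsS
  simp only [Fin.sum_univ_two, Matrix.cons_val_zero, Matrix.cons_val_one, mul_zero,
    add_zero] at h
  generalize ω.1.2 0 = x at *
  generalize ω.1.2 1 = y at *
  have hx : x ≤ 2 := by omega
  obtain ⟨h1, h3⟩ := h2
  interval_cases y <;> interval_cases x <;> omega

/-! ### One slot of the dynamics, over the reals -/

/-- The unused service in the slot described by `ω`. -/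
def slotUnused (ω : (Vec2 × Vec2) × Vec2) : Vec2 := unused ω.1.1 ω.2 ω.1.2

theorem nextState_cast (ω : (Vec2 × Vec2) × Vec2) (i : Fin 2) :
    (nextState ω i : ℝ) = ω.1.1 i + ω.2 i - ω.1.2 i + slotUnused ω i := by
  have : nextState ω i + ω.1.2 i = ω.1.1 i + ω.2 i + slotUnused ω i := by
    simp only [nextState, next, slotUnused, unused]
    omega
  have h : (nextState ω i : ℝ) + ω.1.2 i = ω.1.1 i + ω.2 i + slotUnused ω i := by
    exact_mod_cast this
  linarith

theorem slotUnused_le (ω : (Vec2 × Vec2) × Vec2) (i : Fin 2) : slotUnused ω i ≤ ω.1.2 i :=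
  Nat.sub_le _ _

/-- Complementary slackness: service is unused only when the queue empties. -/
theorem nextState_mul_slotUnused (ω : (Vec2 × Vec2) × Vec2) (i : Fin 2) :
    (nextState ω i : ℝ) * slotUnused ω i = 0 := by
  have : nextState ω i = 0 ∨ slotUnused ω i = 0 := by
    simp only [nextState, next, slotUnused, unused]
    omega
  rcases this with h | h <;> simp [h]

/-- Unused service requires `q < s ≤ 2`, hence `q ≤ 1`. -/
theorem queue_mul_slotUnused_le {ω : (Vec2 × Vec2) × Vec2} {i : Fin 2} (h : ω.1.2 i ≤ 2) :
    (ω.1.1 i : ℝ) * slotUnused ω i ≤ 2 := by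
  have : ω.1.1 i * slotUnused ω i ≤ 2 := by
    simp only [slotUnused, unused]
    rcases Nat.lt_or_ge (ω.1.1 i) (ω.1.2 i) with h1 | h1
    · have h2 : ω.1.1 i ≤ 1 := by omega
      exact (Nat.mul_le_mul h2 ((Nat.sub_le _ _).trans h)).trans (by norm_num)
    · rw [Nat.sub_eq_zero_of_le (by omega)]
      simp
  exact_mod_cast this

/-- Complementary slackness turns the cross term plus `u²` into `-u²`. -/
theorem sq_nextState (ω : (Vec2 × Vec2) × Vec2) (i : Fin 2) :
    (nextState ω i : ℝ) ^ 2 - (ω.1.1 i : ℝ) ^ 2 = 2 * ω.1.1 i * (ω.2 i - ω.1.2 i)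
      + ((ω.2 i : ℝ) - ω.1.2 i) ^ 2 - (slotUnused ω i : ℝ) ^ 2 := by
  have h1 := nextState_cast ω i
  have h2 := nextState_mul_slotUnused ω i
  rw [h1] at h2 ⊢
  linear_combination 2 * h2

namespace IsSlot

variable {ω : (Vec2 × Vec2) × Vec2}

theorem service_le (h : IsSlot A ω) (i : Fin 2) : ω.1.2 i ≤ 2 := by
  have h1 := h.service_add_le
  fin_cases i <;> simp <;> omega

theorem abs_arrival_sub_service_le (h : IsSlot A ω) (i : Fin 2) :
    |(ω.2 i : ℝ) - ω.1.2 i| ≤ A + 2 := by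
  have h1 : (ω.2 i : ℝ) ≤ A := by exact_mod_cast h.arrival_le i
  have h2 : (ω.1.2 i : ℝ) ≤ 2 := by exact_mod_cast h.service_le i
  have h3 : (0 : ℝ) ≤ ω.2 i := Nat.cast_nonneg _
  have h4 : (0 : ℝ) ≤ ω.1.2 i := Nat.cast_nonneg _
  rw [abs_le]
  constructor <;> linarith

theorem weight_le_cast (h : IsSlot A ω) :
    (ω.1.1 0 : ℝ) + ω.1.1 1 ≤ ω.1.1 0 * ω.1.2 0 + ω.1.1 1 * ω.1.2 1 := by
  exact_mod_cast h.weight_le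

end IsSlot

/-- The quadratic Lyapunov function. -/
def sqNorm (q : Vec2) : ℝ := (q 0 : ℝ) ^ 2 + (q 1 : ℝ) ^ 2

/-- The total queue length. -/
def total (q : Vec2) : ℝ := (q 0 : ℝ) + q 1

theorem total_nonneg (q : Vec2) : 0 ≤ total q := by
  unfold total
  positivity

theorem total_le_sqNorm (q : Vec2) : total q ≤ sqNorm q := by
  have h (n : ℕ) : (n : ℝ) ≤ (n : ℝ) ^ 2 := by exact_mod_cast Nat.le_self_pow two_ne_zero n
  exact add_le_add (h _) (h _)

/-- MaxWeight allows `s` to be replaced by `(1,1)` in the linear term; the rest is bounded. -/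
theorem sqNorm_nextState_sub_le {ω : (Vec2 × Vec2) × Vec2} (h : IsSlot A ω) :
    sqNorm (nextState ω) - sqNorm ω.1.1 ≤
      2 * (ω.1.1 0 * ((ω.2 0 : ℝ) - 1) + ω.1.1 1 * ((ω.2 1 : ℝ) - 1)) + 2 * (A + 2 : ℝ) ^ 2 := by
  have h0 := sq_nextState ω 0
  have h1 := sq_nextState ω 1
  have e0 := sq_le_sq' (abs_le.1 (h.abs_arrival_sub_service_le 0)).1
    (abs_le.1 (h.abs_arrival_sub_service_le 0)).2
  have e1 := sq_le_sq' (abs_le.1 (h.abs_arrival_sub_service_le 1)).1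
    (abs_le.1 (h.abs_arrival_sub_service_le 1)).2
  have hw := h.weight_le_cast
  have u0 := sq_nonneg (slotUnused ω 0 : ℝ)
  have u1 := sq_nonneg (slotUnused ω 1 : ℝ)
  unfold sqNorm
  linarith

end Dynamics

/-! ### Finiteness of the mean queue lengths -/

section Moments

variable {S : Set Vec2} {p arr : PMF Vec2} {rule : Vec2 → PMF Vec2} {A : ℕ} {ε : ℝ}

theorem integrable_arrival (hA : ∀ a ∈ arr.support, ∀ i, a i ≤ A) (i : Fin 2) :
    Integrable (fun a : Vec2 => (a i : ℝ)) arr.toMeasure := by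
  refine .of_bound .of_discrete (A : ℝ) ?_
  rw [ae_iff, PMF.toMeasure_apply_eq_zero_iff _ .of_discrete, Set.disjoint_left]
  intro a ha
  simpa using hA a ha i

theorem integral_queue_mul_arrival_sub_one (hA : ∀ a ∈ arr.support, ∀ i, a i ≤ A)
    (hmean : ∀ i, ∫ a, (a i : ℝ) ∂arr.toMeasure = 1 - ε) {g : Vec2 → ℝ}
    (hg : Integrable g p.toMeasure) (i : Fin 2) :
    Integrable (fun ω => g ω.1.1 * ((ω.2 i : ℝ) - 1)) (slotLaw p arr rule) ∧
    ∫ ω, g ω.1.1 * ((ω.2 i : ℝ) - 1) ∂slotLaw p arr rule = -ε * ∫ q, g q ∂p.toMeasure := by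
  have h : Integrable (fun a : Vec2 => (a i : ℝ) - 1) arr.toMeasure :=
    (integrable_arrival hA i).sub (integrable_const 1)
  have hm : ∫ a : Vec2, ((a i : ℝ) - 1) ∂arr.toMeasure = -ε := by
    rw [integral_sub (integrable_arrival hA i) (integrable_const 1), hmean, integral_const,
      probReal_univ, one_smul]
    ring
  refine ⟨integrable_queue_mul_arrival (h := fun a : Vec2 => (a i : ℝ) - 1) hg h, ?_⟩
  rw [integral_queue_mul_arrival g (fun a => (a i : ℝ) - 1), hm, mul_comm]

/-- The function `min (sqNorm q) n` is bounded, so its mean increment is zero. Its increment is at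
most that of `sqNorm` where `sqNorm q < n`, and nonpositive elsewhere. This bounds the mean of
`total` on the former event by `(A + 2)² / ε`, uniformly in `n`. -/
theorem integrable_total_of_stationary (hS : S = pooledSchedules ∨ S = singleSchedules)
    (hMW : IsMaxWeight S rule) (hA : ∀ a ∈ arr.support, ∀ i, a i ≤ A)
    (hmean : ∀ i, ∫ a, (a i : ℝ) ∂arr.toMeasure = 1 - ε) (hε : 0 < ε)
    (hp : p.bind (step arr rule) = p) : Integrable total p.toMeasure := by
  have hcover : AECover p.toMeasure atTop (fun n : ℕ => {q : Vec2 | sqNorm q < n}) := by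
    refine ⟨ae_of_all _ fun q => ?_, fun n => .of_discrete⟩
    obtain ⟨N, hN⟩ := exists_nat_gt (sqNorm q)
    filter_upwards [eventually_ge_atTop N] with n hn
    exact hN.trans_le (by exact_mod_cast hn)
  have hbd (n : ℕ) (i : Fin 2) (q : Vec2) :
      |indicator {q : Vec2 | sqNorm q < n} (fun q => (q i : ℝ)) q| ≤ n := by
    by_cases hq : sqNorm q < n
    · rw [indicator_of_mem (by exact hq), abs_of_nonneg (Nat.cast_nonneg _)]
      refine le_trans ?_ ((total_le_sqNorm q).trans hq.le)
      unfold total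
      fin_cases i <;> simp
    · rw [indicator_of_notMem (by exact hq), abs_zero]
      positivity
  have hind (n : ℕ) (i : Fin 2) :
      Integrable (indicator {q : Vec2 | sqNorm q < n} (fun q => (q i : ℝ))) p.toMeasure :=
    .of_bound .of_discrete n (ae_of_all _ (hbd n i))
  have hsplit (n : ℕ) : indicator {q : Vec2 | sqNorm q < n} total = fun q =>
      indicator {q : Vec2 | sqNorm q < n} (fun q => (q 0 : ℝ)) q +
        indicator {q : Vec2 | sqNorm q < n} (fun q => (q 1 : ℝ)) q := by
    rw [← indicator_add]
    rfl
  refine hcover.integrable_of_integral_bounded_of_nonneg_ae ((A + 2 : ℝ) ^ 2 / ε) (fun n => ?_)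
    (ae_of_all _ total_nonneg) (Eventually.of_forall fun n => ?_)
  · rw [← integrable_indicator_iff .of_discrete, hsplit]
    exact (hind n 0).add (hind n 1)
  · rw [← integral_indicator .of_discrete, hsplit, integral_add (hind n 0) (hind n 1)]
    have hVb (q : Vec2) : |min (sqNorm q) n| ≤ n := by
      rw [abs_of_nonneg (le_min (by unfold sqNorm; positivity) (Nat.cast_nonneg _))]
      exact min_le_right _ _
    have hint : Integrable (fun ω => min (sqNorm (nextState ω)) n - min (sqNorm ω.1.1) n)
        (slotLaw p arr rule) :=
      (integrable_of_ae_bound n (ae_of_all _ fun ω => hVb _)).sub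
        (integrable_of_ae_bound n (ae_of_all _ fun ω => hVb _))
    have hz := integral_nextState_sub hp (fun q => min (sqNorm q) n) hint
    have h0 := integral_queue_mul_arrival_sub_one (rule := rule) hA hmean (hind n 0) 0
    have h1 := integral_queue_mul_arrival_sub_one (rule := rule) hA hmean (hind n 1) 1
    have hle := integral_mono_ae hint
      (((h0.1.add h1.1).const_mul 2).add (integrable_const (2 * (A + 2 : ℝ) ^ 2))) (by
        filter_upwards [ae_isSlot hS hMW hA] with ω hω
        simp only [Pi.add_apply]
        by_cases hq : sqNorm ω.1.1 < n
        · rw [indicator_of_mem (by exact hq), indicator_of_mem (by exact hq), min_eq_left hq.le]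
          exact (sub_le_sub_right (min_le_left _ _) _).trans (sqNorm_nextState_sub_le hω)
        · rw [indicator_of_notMem (by exact hq), indicator_of_notMem (by exact hq),
            min_eq_right (not_lt.1 hq)]
          have := min_le_right (sqNorm (nextState ω)) n
          have h2 := sq_nonneg (A + 2 : ℝ)
          linarith)
    rw [hz, integral_add' ((h0.1.add h1.1).const_mul 2) (integrable_const _),
      integral_const_mul, integral_add' h0.1 h1.1, h0.2, h1.2, integral_const] at hle
    simp only [probReal_univ, smul_eq_mul, one_mul] at hle
    rw [le_div_iff₀ hε]
    linarith

end Moments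

/-! ### Existence of a stationary law -/

/-- Markov's inequality outside the box `[0, M)²`; it supplies tightness. -/
theorem one_le_sum_add {p : PMF Vec2} (hp : Integrable total p.toMeasure) {M : ℕ} (hM : 0 < M) :
    1 ≤ ∑ x ∈ Fintype.piFinset (fun _ : Fin 2 => Finset.range M), p x +
      ENNReal.ofReal ((∫ q, total q ∂p.toMeasure) / M) := by
  set F := Fintype.piFinset (fun _ : Fin 2 => Finset.range M)
  have hF : p.toMeasure F = ∑ x ∈ F, p x :=
    PMF.toMeasure_apply_finset _ _
  have hsub : (F : Set Vec2)ᶜ ⊆ {q | (M : ℝ) ≤ total q} := by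
    intro q hq
    simp only [F, mem_compl_iff, Finset.mem_coe, Fintype.mem_piFinset, Finset.mem_range,
      Fin.forall_fin_two, not_and_or, not_lt] at hq
    have : M ≤ q 0 + q 1 := by omega
    simp only [total, mem_ofPred_eq]
    exact_mod_cast this
  have hmk := mul_meas_ge_le_integral_of_nonneg (ae_of_all _ total_nonneg) hp (M : ℝ)
  have h1 : p.toMeasure (F : Set Vec2)ᶜ ≤ ENNReal.ofReal ((∫ q, total q ∂p.toMeasure) / M) := by
    refine (measure_mono hsub).trans ?_
    rw [← ofReal_measureReal]
    refine ENNReal.ofReal_le_ofReal ?_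
    rw [le_div_iff₀ (by exact_mod_cast hM), mul_comm]
    exact hmk
  calc (1 : ENNReal) = p.toMeasure univ := measure_univ.symm
    _ = p.toMeasure F + p.toMeasure (F : Set Vec2)ᶜ :=
      (measure_add_measure_compl .of_discrete).symm
    _ ≤ _ := by rw [hF]; gcongr

/-- A chain whose mean total queue length is bounded on average over time has a stationary law. -/
theorem exists_bind_eq (P : Vec2 → PMF Vec2) (init : PMF Vec2) (C : ℝ)
    (hint : ∀ k, Integrable total (law P init k).toMeasure)
    (hC : ∀ n : ℕ, ∑ k ∈ Finset.range n, ∫ q, total q ∂(law P init k).toMeasure ≤ n * C) :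
    ∃ π : PMF Vec2, π.bind P = π := by
  let m : ℕ → Vec2 → ENNReal := fun n x =>
    ((n + 1 : ℕ) : ENNReal)⁻¹ * ∑ k ∈ Finset.range (n + 1), law P init k x
  have hinv (n : ℕ) : ((n + 1 : ℕ) : ENNReal)⁻¹ * ((n + 1 : ℕ) : ENNReal) = 1 :=
    ENNReal.inv_mul_cancel (by simp) (by finiteness)
  -- `ENNReal` is compact, so along an ultrafilter all the time averages `m n x` converge at once,
  -- without a diagonal subsequence.
  let U : Ultrafilter ℕ := hyperfilter ℕ
  let w : Vec2 → ENNReal := fun x => (U.map fun n => m n x).lim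
  have hw (x : Vec2) : Tendsto (fun n => m n x) U (𝓝 (w x)) :=
    Ultrafilter.le_nhds_lim (U.map fun n => m n x)
  have hU : (U : Filter ℕ) ≤ atTop := Nat.hyperfilter_le_atTop
  have hsum (n : ℕ) (F : Finset Vec2) : ∑ x ∈ F, m n x =
      ((n + 1 : ℕ) : ENNReal)⁻¹ * ∑ k ∈ Finset.range (n + 1), ∑ x ∈ F, law P init k x := by
    rw [Finset.sum_comm, ← Finset.mul_sum]
  have hle : ∑' x, w x ≤ 1 := by
    rw [ENNReal.tsum_eq_iSup_sum]
    refine iSup_le fun F => le_of_tendsto (tendsto_finsetSum F fun x _ => hw x)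
      (Eventually.of_forall fun n => ?_)
    rw [hsum, ← hinv n]
    gcongr
    calc _ ≤ ∑ k ∈ Finset.range (n + 1), (1 : ENNReal) := by
          refine Finset.sum_le_sum fun k _ => ?_
          rw [← (law P init k).tsum_coe]
          exact ENNReal.sum_le_tsum F
      _ = _ := by simp
  -- No mass escapes to infinity: each average puts mass at most `C / M` outside the box.
  have hge (M : ℕ) (hM : 0 < M) : 1 ≤ ∑' x, w x + ENNReal.ofReal (C / M) := by
    let F := Fintype.piFinset (fun _ : Fin 2 => Finset.range M)
    refine le_trans (b := ∑ x ∈ F, w x + ENNReal.ofReal (C / M)) ?_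
      (by gcongr; exact ENNReal.sum_le_tsum F)
    refine ge_of_tendsto ((tendsto_finsetSum F fun x _ => hw x).add tendsto_const_nhds)
      (Eventually.of_forall fun n => ?_)
    have hI (k : ℕ) : 0 ≤ (∫ q, total q ∂(law P init k).toMeasure) / M :=
      div_nonneg (integral_nonneg total_nonneg) (Nat.cast_nonneg _)
    have h1 : ENNReal.ofReal (∑ k ∈ Finset.range (n + 1),
        (∫ q, total q ∂(law P init k).toMeasure) / M) ≤
        ((n + 1 : ℕ) : ENNReal) * ENNReal.ofReal (C / M) := by
      rw [← ENNReal.ofReal_natCast (n + 1), ← ENNReal.ofReal_mul (Nat.cast_nonneg _)]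
      refine ENNReal.ofReal_le_ofReal ?_
      rw [← Finset.sum_div, ← mul_div_assoc]
      gcongr
      exact hC (n + 1)
    rw [ENNReal.ofReal_sum_of_nonneg fun k _ => hI k] at h1
    calc (1 : ENNReal) = ((n + 1 : ℕ) : ENNReal)⁻¹ * ∑ k ∈ Finset.range (n + 1), 1 := by
          rw [Finset.sum_const, Finset.card_range, nsmul_eq_mul, mul_one, hinv]
      _ ≤ ((n + 1 : ℕ) : ENNReal)⁻¹ * ∑ k ∈ Finset.range (n + 1), (∑ x ∈ F, law P init k x +
            ENNReal.ofReal ((∫ q, total q ∂(law P init k).toMeasure) / M)) := by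
          gcongr with k _
          exact one_le_sum_add (hint k) hM
      _ = ∑ x ∈ F, m n x + ((n + 1 : ℕ) : ENNReal)⁻¹ * ∑ k ∈ Finset.range (n + 1),
            ENNReal.ofReal ((∫ q, total q ∂(law P init k).toMeasure) / M) := by
          rw [hsum, Finset.sum_add_distrib, mul_add]
      _ ≤ ∑ x ∈ F, m n x + ((n + 1 : ℕ) : ENNReal)⁻¹ *
            (((n + 1 : ℕ) : ENNReal) * ENNReal.ofReal (C / M)) := by gcongr
      _ = ∑ x ∈ F, m n x + ENNReal.ofReal (C / M) := by rw [← mul_assoc, hinv, one_mul]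
  have hone : ∑' x, w x = 1 := by
    refine le_antisymm hle ?_
    have hlim : Tendsto (fun M : ℕ => ∑' x, w x + ENNReal.ofReal (C / M)) atTop
        (𝓝 (∑' x, w x + ENNReal.ofReal 0)) :=
      tendsto_const_nhds.add (ENNReal.tendsto_ofReal (tendsto_const_div_atTop_nhds_zero_nat C))
    rw [ENNReal.ofReal_zero, add_zero] at hlim
    refine ge_of_tendsto hlim ?_
    filter_upwards [eventually_gt_atTop 0] with M hM using hge M hM
  let π : PMF Vec2 := ⟨w, hone ▸ ENNReal.summable.hasSum⟩
  -- One step of the chain shifts the averaging window by one, which adds at most `1 / (n + 1)` at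
  -- any point.
  refine ⟨π, bind_eq_of_tendsto (l := (U : Filter ℕ)) (m := m)
    (m' := fun n y => m n y + ((n + 1 : ℕ) : ENNReal)⁻¹) hw (fun y => ?_) fun n y => ?_⟩
  · have h0 : Tendsto (fun n : ℕ => ((n + 1 : ℕ) : ENNReal)⁻¹) U (𝓝 0) :=
      ((tendsto_add_atTop_iff_nat 1).2 ENNReal.tendsto_inv_nat_nhds_zero).mono_left hU
    have := (hw y).add h0
    rwa [add_zero] at this
  · calc ∑' x, m n x * P x y = ((n + 1 : ℕ) : ENNReal)⁻¹ *
          ∑ k ∈ Finset.range (n + 1), law P init (k + 1) y := by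
          simp only [m, mul_assoc, Finset.sum_mul]
          rw [ENNReal.tsum_mul_left, Summable.tsum_finsetSum fun _ _ => ENNReal.summable]
          rfl
      _ ≤ ((n + 1 : ℕ) : ENNReal)⁻¹ *
          (∑ k ∈ Finset.range (n + 1), law P init k y + 1) := by
          gcongr
          refine le_trans (b := ∑ k ∈ Finset.range (n + 2), law P init k y) ?_ ?_
          · rw [Finset.sum_range_succ' _ (n + 1)]
            exact le_self_add
          · rw [Finset.sum_range_succ _ (n + 1)]
            gcongr
            exact PMF.coe_le_one _ _
      _ = _ := by rw [mul_add, mul_one]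

section Existence

variable {S : Set Vec2} {arr : PMF Vec2} {rule : Vec2 → PMF Vec2} {A : ℕ} {ε : ℝ}

/-- Started empty, the chain has bounded support at each time, so all moments are finite. -/
theorem law_support_le (hA : ∀ a ∈ arr.support, ∀ i, a i ≤ A) (k : ℕ) :
    ∀ q ∈ (law (step arr rule) (PMF.pure 0) k).support, ∀ i, q i ≤ k * A := by
  induction k with
  | zero => simp [law]
  | succ k ih =>
    intro q' hq' i
    simp only [law, step, PMF.mem_support_bind_iff, PMF.mem_support_map_iff] at hq'
    obtain ⟨q, hq, s, -, a, ha, rfl⟩ := hq'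
    have h1 := ih q hq i
    have h2 := hA a ha i
    simp only [next, unused]
    rw [Nat.succ_mul]
    omega

/-- Summing the drift of `sqNorm` from the empty state bounds the time-averaged mean of `total` by
`(A + 2)² / ε`. -/
theorem exists_stationary (hS : S = pooledSchedules ∨ S = singleSchedules)
    (hMW : IsMaxWeight S rule) (hA : ∀ a ∈ arr.support, ∀ i, a i ≤ A)
    (hmean : ∀ i, ∫ a, (a i : ℝ) ∂arr.toMeasure = 1 - ε) (hε : 0 < ε) :
    ∃ π : PMF Vec2, π.bind (step arr rule) = π := by
  set μ := law (step arr rule) (PMF.pure 0) with hμ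
  have hae (k : ℕ) : ∀ᵐ q ∂(μ k).toMeasure, ∀ i, q i ≤ k * A := by
    rw [ae_iff, PMF.toMeasure_apply_eq_zero_iff _ .of_discrete, Set.disjoint_left]
    intro q hq
    simp only [mem_ofPred_eq, not_not]
    exact law_support_le hA k q hq
  have hcoord (k : ℕ) (i : Fin 2) : Integrable (fun q : Vec2 => (q i : ℝ)) (μ k).toMeasure := by
    refine .of_bound .of_discrete ((k * A : ℕ) : ℝ) ?_
    filter_upwards [hae k] with q hq
    rw [Real.norm_natCast]
    exact_mod_cast hq i
  have htot (k : ℕ) : Integrable total (μ k).toMeasure := (hcoord k 0).add (hcoord k 1)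
  have hsq (k : ℕ) : Integrable sqNorm (μ k).toMeasure := by
    refine .of_bound .of_discrete (((k * A : ℕ) : ℝ) ^ 2 + ((k * A : ℕ) : ℝ) ^ 2) ?_
    filter_upwards [hae k] with q hq
    rw [Real.norm_of_nonneg (by unfold sqNorm; positivity)]
    unfold sqNorm
    have h0 := hq 0
    have h1 := hq 1
    gcongr
  have hdrift (k : ℕ) : ∫ q, sqNorm q ∂(μ (k + 1)).toMeasure - ∫ q, sqNorm q ∂(μ k).toMeasure ≤
      -(2 * ε) * ∫ q, total q ∂(μ k).toMeasure + 2 * (A + 2 : ℝ) ^ 2 := by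
    have h0 := integral_queue_mul_arrival_sub_one (rule := rule) hA hmean (hcoord k 0) 0
    have h1 := integral_queue_mul_arrival_sub_one (rule := rule) hA hmean (hcoord k 1) 1
    have hn : Integrable (fun ω => sqNorm (nextState ω)) (slotLaw (μ k) arr rule) := by
      have := hsq (k + 1)
      rw [show μ (k + 1) = (μ k).bind (step arr rule) from rfl, ← map_nextState_slotLaw] at this
      exact this.comp_measurable .of_discrete
    have hle := integral_mono_ae (hn.sub (integrable_queue (hsq k)))
      (((h0.1.add h1.1).const_mul 2).add (integrable_const (2 * (A + 2 : ℝ) ^ 2))) (by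
        filter_upwards [ae_isSlot hS hMW hA] with ω hω using sqNorm_nextState_sub_le hω)
    rw [integral_sub' hn (integrable_queue (hsq k)), integral_nextState, integral_queue,
      integral_add' ((h0.1.add h1.1).const_mul 2) (integrable_const _),
      integral_const_mul, integral_add' h0.1 h1.1, h0.2, h1.2, integral_const] at hle
    simp only [probReal_univ, smul_eq_mul, one_mul] at hle
    have ht : ∫ q, total q ∂(μ k).toMeasure =
      ∫ q, (q 0 : ℝ) ∂(μ k).toMeasure + ∫ q, (q 1 : ℝ) ∂(μ k).toMeasure :=
      integral_add (hcoord k 0) (hcoord k 1)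
    rw [ht]
    refine hle.trans (le_of_eq ?_)
    ring
  refine exists_bind_eq _ (PMF.pure 0) ((A + 2 : ℝ) ^ 2 / ε) htot fun n => ?_
  have htel : ∫ q, sqNorm q ∂(μ n).toMeasure - ∫ q, sqNorm q ∂(μ 0).toMeasure ≤
      -(2 * ε) * ∑ k ∈ Finset.range n, ∫ q, total q ∂(μ k).toMeasure +
        n * (2 * (A + 2 : ℝ) ^ 2) := by
    rw [← Finset.sum_range_sub (fun k => ∫ q, sqNorm q ∂(μ k).toMeasure)]
    refine (Finset.sum_le_sum fun k _ => hdrift k).trans (le_of_eq ?_)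
    rw [Finset.sum_add_distrib, ← Finset.mul_sum]
    simp
  have hz : ∫ q, sqNorm q ∂(μ 0).toMeasure = 0 := by
    rw [show ∫ q, sqNorm q ∂(μ 0).toMeasure = ∫ _, (0 : ℝ) ∂(μ 0).toMeasure from
      integral_congr_ae (by
        filter_upwards [hae 0] with q hq
        have h0 := hq 0
        have h1 := hq 1
        rw [Nat.zero_mul, Nat.le_zero] at h0 h1
        simp [sqNorm, h0, h1])]
    simp
  have hpos : 0 ≤ ∫ q, sqNorm q ∂(μ n).toMeasure :=
    integral_nonneg fun q => by unfold sqNorm; positivity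
  rw [← mul_div_assoc, le_div_iff₀ hε]
  linarith

end Existence

/-! ### The heavy-traffic estimate -/

/-- The excess of queue `0` over queue `1`. -/
noncomputable def excess (q : Vec2) : ℝ := max ((q 0 : ℝ) - q 1) 0

theorem excess_nonneg (q : Vec2) : 0 ≤ excess q := le_max_right _ _

theorem excess_le_total (q : Vec2) : excess q ≤ total q := by
  have h0 : (0 : ℝ) ≤ q 0 := Nat.cast_nonneg _
  have h1 : (0 : ℝ) ≤ q 1 := Nat.cast_nonneg _
  exact max_le (by unfold total; linarith) (total_nonneg q)

/-- The gain in weight of the schedule over serving one job from each queue. -/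
def weightGain (ω : (Vec2 × Vec2) × Vec2) : ℝ :=
  ω.1.1 0 * ((ω.1.2 0 : ℝ) - 1) + ω.1.1 1 * ((ω.1.2 1 : ℝ) - 1)

/-- The part of the second-order term of the quadratic drift that is negligible in heavy
traffic. -/
def remainder (ω : (Vec2 × Vec2) × Vec2) : ℝ :=
  (1 - (ω.1.2 0 : ℝ)) * (2 * ω.2 0 - ω.1.2 0 - 1) - (slotUnused ω 0 : ℝ) ^ 2 +
    ((1 - (ω.1.2 1 : ℝ)) * (2 * ω.2 1 - ω.1.2 1 - 1) - (slotUnused ω 1 : ℝ) ^ 2)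

/-- Uses `(a - s)² = (a - 1)² + (1 - s)(2a - s - 1)`. -/
theorem sqNorm_nextState_sub_eq (ω : (Vec2 × Vec2) × Vec2) :
    sqNorm (nextState ω) - sqNorm ω.1.1 =
      2 * (ω.1.1 0 * ((ω.2 0 : ℝ) - 1) + ω.1.1 1 * ((ω.2 1 : ℝ) - 1)) - 2 * weightGain ω +
        (((ω.2 0 : ℝ) - 1) ^ 2 + ((ω.2 1 : ℝ) - 1) ^ 2) + remainder ω := by
  have h0 := sq_nextState ω 0
  have h1 := sq_nextState ω 1
  unfold sqNorm weightGain remainder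
  linear_combination h0 + h1

/-! ### Pathwise bounds for one slot -/

section Slot

variable {ω : (Vec2 × Vec2) × Vec2} {A : ℕ}

theorem slotUnused_cast_nonneg (i : Fin 2) : (0 : ℝ) ≤ slotUnused ω i := Nat.cast_nonneg _

theorem slotUnused_cast_le (i : Fin 2) : (slotUnused ω i : ℝ) ≤ ω.1.2 i := by
  exact_mod_cast slotUnused_le ω i

namespace IsSlot

theorem service_one_le_cast (h : IsSlot A ω) : (ω.1.2 1 : ℝ) ≤ 1 := by
  exact_mod_cast h.service_one_le

theorem service_add_le_cast (h : IsSlot A ω) : (ω.1.2 0 : ℝ) + ω.1.2 1 ≤ 2 := by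
  exact_mod_cast h.service_add_le

theorem service_le_cast (h : IsSlot A ω) (i : Fin 2) : (ω.1.2 i : ℝ) ≤ 2 := by
  exact_mod_cast h.service_le i

theorem arrival_le_cast (h : IsSlot A ω) (i : Fin 2) : (ω.2 i : ℝ) ≤ A := by
  exact_mod_cast h.arrival_le i

theorem abs_nextState_sub_le (h : IsSlot A ω) (i : Fin 2) :
    |(nextState ω i : ℝ) - ω.1.1 i| ≤ A + 2 := by
  have h1 := h.arrival_le_cast i
  have h2 := h.service_le_cast i
  have h3 := slotUnused_cast_nonneg (ω := ω) i
  have h4 := slotUnused_cast_le (ω := ω) i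
  have h5 : (0 : ℝ) ≤ ω.2 i := Nat.cast_nonneg _
  rw [nextState_cast, abs_le]
  constructor <;> linarith

theorem weightGain_nonneg (h : IsSlot A ω) : 0 ≤ weightGain ω := by
  have := h.weight_le_cast
  unfold weightGain
  linarith

/-- Since `s₀ ≤ 2 - s₁`, the gain is at most `(q₀ - q₁)(1 - s₁)`, with `0 ≤ 1 - s₁ ≤ 1`. -/
theorem weightGain_le_excess (h : IsSlot A ω) : weightGain ω ≤ excess ω.1.1 := by
  have h1 := h.service_one_le_cast
  have h2 := h.service_add_le_cast
  have h4 : (0 : ℝ) ≤ ω.1.2 1 := Nat.cast_nonneg _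
  have hq0 : (0 : ℝ) ≤ ω.1.1 0 := Nat.cast_nonneg _
  have h5 : weightGain ω ≤ ((ω.1.1 0 : ℝ) - ω.1.1 1) * (1 - ω.1.2 1) := by
    have := mul_nonneg hq0 (sub_nonneg.2 h2)
    unfold weightGain
    linarith
  have h6 : ((ω.1.1 0 : ℝ) - ω.1.1 1) ≤ excess ω.1.1 := le_max_left _ _
  have h7 := mul_le_mul_of_nonneg_right h6 (sub_nonneg.2 h1)
  have h8 := mul_nonneg (excess_nonneg ω.1.1) h4
  linarith

/-- Each term has a factor `1 - sᵢ` or `uᵢ`. The term `1 - s₁` counts twice because `|1 - s₀| ≤ (2 -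
s₀ - s₁) + (1 - s₁)`. -/
theorem abs_remainder_le (h : IsSlot A ω) : |remainder ω| ≤
    (2 * A + 3) * ((2 - ω.1.2 0 - ω.1.2 1) + 2 * (1 - ω.1.2 1) +
      slotUnused ω 0 + slotUnused ω 1) := by
  have hu (i : Fin 2) : |(slotUnused ω i : ℝ) ^ 2| ≤ (2 * A + 3) * slotUnused ω i := by
    have h1 := slotUnused_cast_nonneg (ω := ω) i
    have h2 := (slotUnused_cast_le (ω := ω) i).trans (h.service_le_cast i)
    have h3 : (0 : ℝ) ≤ A := Nat.cast_nonneg _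
    rw [abs_of_nonneg (sq_nonneg _), sq]
    gcongr
    linarith
  have hs (i : Fin 2) : |(1 - (ω.1.2 i : ℝ)) * (2 * ω.2 i - ω.1.2 i - 1)| ≤
      (2 * A + 3) * |1 - (ω.1.2 i : ℝ)| := by
    have h1 := h.arrival_le_cast i
    have h2 := h.service_le_cast i
    have h3 : (0 : ℝ) ≤ ω.1.2 i := Nat.cast_nonneg _
    have h4 : (0 : ℝ) ≤ ω.2 i := Nat.cast_nonneg _
    rw [abs_mul, mul_comm]
    gcongr
    rw [abs_le]
    constructor <;> linarith
  have h1 : |1 - (ω.1.2 1 : ℝ)| = 1 - ω.1.2 1 := abs_of_nonneg (by linarith [h.service_one_le_cast])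
  have h0 : |1 - (ω.1.2 0 : ℝ)| ≤ (2 - ω.1.2 0 - ω.1.2 1) + (1 - ω.1.2 1) := by
    have := h.service_one_le_cast
    have := h.service_add_le_cast
    rw [abs_le]
    constructor <;> linarith
  have hs0 := (hs 0).trans (mul_le_mul_of_nonneg_left h0 (by positivity))
  have hs1 := hs 1
  rw [h1] at hs1
  unfold remainder
  refine (abs_add_le _ _).trans ?_
  have e0 := abs_sub ((1 - (ω.1.2 0 : ℝ)) * (2 * ω.2 0 - ω.1.2 0 - 1)) ((slotUnused ω 0 : ℝ) ^ 2)
  have e1 := abs_sub ((1 - (ω.1.2 1 : ℝ)) * (2 * ω.2 1 - ω.1.2 1 - 1)) ((slotUnused ω 1 : ℝ) ^ 2)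
  have u0 := hu 0
  have u1 := hu 1
  linarith

theorem abs_excess_nextState_sub_le (h : IsSlot A ω) :
    |excess (nextState ω) - excess ω.1.1| ≤ 2 * (A + 2) := by
  have h0 := abs_le.1 (h.abs_nextState_sub_le 0)
  have h1 := abs_le.1 (h.abs_nextState_sub_le 1)
  refine (abs_max_sub_max_le_abs _ _ _).trans ?_
  rw [abs_le]
  constructor <;> linarith

/-- The quadratic drift of the excess when a larger queue `0` attracts both servers. -/
theorem excess_drift_le (h : IsSlot A ω)
    (hpool : ω.1.1 1 < ω.1.1 0 → ω.1.2 0 = 2 ∧ ω.1.2 1 = 0) :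
    (excess (nextState ω) ^ 2 - (A + 2) * excess (nextState ω)) -
        (excess ω.1.1 ^ 2 - (A + 2) * excess ω.1.1) ≤
      2 * (excess ω.1.1 * ((ω.2 0 : ℝ) - 1) - excess ω.1.1 * ((ω.2 1 : ℝ) - 1)) -
        4 * excess ω.1.1 + (4 + 2 * (A + 2 : ℝ) ^ 2) * (1 - ω.1.2 1) := by
  have ha0 := h.arrival_le_cast 0
  have ha1 := h.arrival_le_cast 1
  have ha0' : (0 : ℝ) ≤ ω.2 0 := Nat.cast_nonneg _
  have ha1' : (0 : ℝ) ≤ ω.2 1 := Nat.cast_nonneg _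
  have hu0 := slotUnused_cast_nonneg (ω := ω) 0
  have hu1 := slotUnused_cast_nonneg (ω := ω) 1
  have hu0' := slotUnused_cast_le (ω := ω) 0
  have hu1' := slotUnused_cast_le (ω := ω) 1
  have n0 := nextState_cast ω 0
  have n1 := nextState_cast ω 1
  have hs1 := h.service_one_le_cast
  have hw' := excess_nonneg (nextState ω)
  -- If `q₁ < q₀` then `1 - s₁ = 1`, and the constant collects `2 w u₀ ≤ 4`, `c² ≤ (A + 2)²` and `(A
  -- + 2)²` from the linear correction. Otherwise the excess starts at `0` and ends in `[0, A + 2]`,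
  -- where the correction makes the test function nonpositive, so no constant is paid.
  rcases lt_or_ge (ω.1.1 1) (ω.1.1 0) with hlt | hge
  · obtain ⟨hs0, hs1⟩ := hpool hlt
    have hlt' : (ω.1.1 1 : ℝ) < ω.1.1 0 := by exact_mod_cast hlt
    have hq1 : (0 : ℝ) ≤ ω.1.1 1 := Nat.cast_nonneg _
    have hw : excess ω.1.1 = ω.1.1 0 - ω.1.1 1 := max_eq_left (by linarith)
    have hqu := queue_mul_slotUnused_le (h.service_le 0)
    rw [hs0] at n0 hu0'
    rw [hs1] at n1 hu1'
    rw [hs1, hw]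
    push_cast at *
    set u0 : ℝ := (slotUnused ω 0 : ℝ)
    have hu1z : (slotUnused ω 1 : ℝ) = 0 := le_antisymm hu1' hu1
    rw [hu1z] at n1
    set w : ℝ := (ω.1.1 0 : ℝ) - ω.1.1 1
    set c : ℝ := (ω.2 0 : ℝ) - ω.2 1 - 2 + u0
    have hd : (nextState ω 0 : ℝ) - nextState ω 1 = w + c := by simp only [w, c]; linarith
    have hge1 : w + c ≤ excess (nextState ω) := hd ▸ le_max_left _ _
    have hsq : excess (nextState ω) ^ 2 ≤ (w + c) ^ 2 := by
      unfold excess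
      rw [hd]
      rcases le_total (w + c) 0 with h1 | h1
      · rw [max_eq_right h1]
        nlinarith [sq_nonneg (w + c)]
      · rw [max_eq_left h1]
    have hwu : w * u0 ≤ 2 := by
      have := mul_nonneg hq1 hu0
      simp only [w]
      nlinarith
    have hc1 : -(A + 2) ≤ c := by simp only [c]; linarith
    have hc2 : c ≤ A + 2 := by simp only [c]; linarith
    have hc : c ^ 2 ≤ (A + 2 : ℝ) ^ 2 := sq_le_sq' hc1 hc2
    have hB : (A + 2 : ℝ) * (w - excess (nextState ω)) ≤ (A + 2) * (A + 2) := by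
      gcongr
      linarith
    have hwc : w * c = w * ((ω.2 0 : ℝ) - 1) - w * ((ω.2 1 : ℝ) - 1) - 2 * w + w * u0 := by
      simp only [c]
      ring
    have hexp : (w + c) ^ 2 = w ^ 2 + 2 * (w * c) + c ^ 2 := by ring
    linarith
  · have hge' : (ω.1.1 0 : ℝ) ≤ ω.1.1 1 := by exact_mod_cast hge
    have hw : excess ω.1.1 = 0 := max_eq_right (by linarith)
    have hle : excess (nextState ω) ≤ A + 2 := by
      refine max_le ?_ (by positivity)
      linarith
    rw [hw]
    have h1 : excess (nextState ω) * (excess (nextState ω) - (A + 2)) ≤ 0 :=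
      mul_nonpos_of_nonneg_of_nonpos hw' (by linarith)
    have h2 : 0 ≤ (4 + 2 * (A + 2 : ℝ) ^ 2) * (1 - ω.1.2 1) :=
      mul_nonneg (by positivity) (by linarith)
    linarith

end IsSlot

end Slot

/-! ### Steady-state expectations and state-space collapse -/

section HeavyTraffic

theorem integrable_fun_sub {α : Type*} [MeasurableSpace α] {μ : Measure α} {f g : α → ℝ}
    (hf : Integrable f μ) (hg : Integrable g μ) : Integrable (fun x => f x - g x) μ :=
  hf.sub hg

variable {S : Set Vec2} {p arr : PMF Vec2} {rule : Vec2 → PMF Vec2} {A : ℕ} {ε : ℝ}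

theorem integrable_service (hS : S = pooledSchedules ∨ S = singleSchedules)
    (hMW : IsMaxWeight S rule) (hA : ∀ a ∈ arr.support, ∀ i, a i ≤ A) (i : Fin 2) :
    Integrable (fun ω => (ω.1.2 i : ℝ)) (slotLaw p arr rule) := by
  refine integrable_of_ae_bound 2 ?_
  filter_upwards [ae_isSlot hS hMW hA] with ω hω
  rw [abs_of_nonneg (Nat.cast_nonneg _)]
  exact hω.service_le_cast i

theorem integrable_slotUnused (hS : S = pooledSchedules ∨ S = singleSchedules)
    (hMW : IsMaxWeight S rule) (hA : ∀ a ∈ arr.support, ∀ i, a i ≤ A) (i : Fin 2) :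
    Integrable (fun ω => (slotUnused ω i : ℝ)) (slotLaw p arr rule) := by
  refine integrable_of_ae_bound 2 ?_
  filter_upwards [ae_isSlot hS hMW hA] with ω hω
  rw [abs_of_nonneg (Nat.cast_nonneg _)]
  exact (slotUnused_cast_le i).trans (hω.service_le_cast i)

/-- In steady state, the mean service is the mean arrival plus the mean unused service. -/
theorem integral_service (hS : S = pooledSchedules ∨ S = singleSchedules)
    (hMW : IsMaxWeight S rule) (hA : ∀ a ∈ arr.support, ∀ i, a i ≤ A)
    (hmean : ∀ i, ∫ a, (a i : ℝ) ∂arr.toMeasure = 1 - ε)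
    (hp : p.bind (step arr rule) = p) (i : Fin 2) :
    ∫ ω, (ω.1.2 i : ℝ) ∂slotLaw p arr rule =
      1 - ε + ∫ ω, (slotUnused ω i : ℝ) ∂slotLaw p arr rule := by
  have hs := integrable_service (p := p) hS hMW hA i
  have hu := integrable_slotUnused (p := p) hS hMW hA i
  have ha : Integrable (fun ω => (ω.2 i : ℝ)) (slotLaw p arr rule) := by
    refine integrable_of_ae_bound A ?_
    filter_upwards [ae_isSlot hS hMW hA] with ω hω
    rw [abs_of_nonneg (Nat.cast_nonneg _)]
    exact hω.arrival_le_cast i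
  have heq : (fun ω => (nextState ω i : ℝ) - ω.1.1 i) =
      fun ω => (ω.2 i : ℝ) - ω.1.2 i + slotUnused ω i := by
    funext ω
    rw [nextState_cast]
    ring
  have hz := integral_nextState_sub hp (fun q => (q i : ℝ)) (by
    simp only [heq]
    exact (ha.sub hs).add hu)
  simp only [heq] at hz
  rw [integral_add (integrable_fun_sub ha hs) hu, integral_sub ha hs,
    integral_arrival (fun a => (a i : ℝ)), hmean] at hz
  linarith

/-- Stationarity forces the mean service of queue `1` to be at least `1 - ε`. -/
theorem integral_idle_le (hS : S = pooledSchedules ∨ S = singleSchedules)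
    (hMW : IsMaxWeight S rule) (hA : ∀ a ∈ arr.support, ∀ i, a i ≤ A)
    (hmean : ∀ i, ∫ a, (a i : ℝ) ∂arr.toMeasure = 1 - ε)
    (hp : p.bind (step arr rule) = p) :
    ∫ ω, (1 - (ω.1.2 1 : ℝ)) ∂slotLaw p arr rule ≤ ε := by
  rw [integral_sub (integrable_const _) (integrable_service hS hMW hA 1),
    integral_service hS hMW hA hmean hp, integral_const, probReal_univ, one_smul]
  have : 0 ≤ ∫ ω, (slotUnused ω 1 : ℝ) ∂slotLaw p arr rule :=
    integral_nonneg fun ω => slotUnused_cast_nonneg 1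
  linarith

/-- The mean of `2 - s₀ - s₁` is `2ε - E u₀ - E u₁`, so the unused service cancels; the middle term
costs another `2ε`. -/
theorem integral_slack_le (hS : S = pooledSchedules ∨ S = singleSchedules)
    (hMW : IsMaxWeight S rule) (hA : ∀ a ∈ arr.support, ∀ i, a i ≤ A)
    (hmean : ∀ i, ∫ a, (a i : ℝ) ∂arr.toMeasure = 1 - ε)
    (hp : p.bind (step arr rule) = p) :
    Integrable (fun ω => (2 - (ω.1.2 0 : ℝ) - ω.1.2 1) + 2 * (1 - (ω.1.2 1 : ℝ)) +
      slotUnused ω 0 + slotUnused ω 1) (slotLaw p arr rule) ∧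
    ∫ ω, ((2 - (ω.1.2 0 : ℝ) - ω.1.2 1) + 2 * (1 - (ω.1.2 1 : ℝ)) +
      slotUnused ω 0 + slotUnused ω 1) ∂slotLaw p arr rule ≤ 4 * ε := by
  have s0 := integrable_service (p := p) hS hMW hA 0
  have s1 := integrable_service (p := p) hS hMW hA 1
  have u0 := integrable_slotUnused (p := p) hS hMW hA 0
  have u1 := integrable_slotUnused (p := p) hS hMW hA 1
  have c2 := integrable_const (μ := slotLaw p arr rule) (2 : ℝ)
  have i1 := integrable_fun_sub (integrable_fun_sub c2 s0) s1
  have i2 := (integrable_fun_sub (integrable_const (μ := slotLaw p arr rule) (1 : ℝ)) s1).const_mul 2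
  refine ⟨((i1.add i2).add u0).add u1, ?_⟩
  have e0 := integral_service hS hMW hA hmean hp 0
  have e1 := integral_service hS hMW hA hmean hp 1
  have hid := integral_idle_le hS hMW hA hmean hp
  rw [integral_add ((i1.fun_add i2).fun_add u0) u1, integral_add (i1.fun_add i2) u0,
    integral_add i1 i2, integral_const_mul,
    integral_sub (integrable_fun_sub c2 s0) s1, integral_sub c2 s0, integral_const, probReal_univ, one_smul]
  linarith

theorem integrable_excess (ht : Integrable total p.toMeasure) : Integrable excess p.toMeasure :=
  ht.mono' .of_discrete (ae_of_all _ fun q => by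
    rw [Real.norm_of_nonneg (excess_nonneg q)]
    exact excess_le_total q)

/-- State-space collapse: with pooling, the mean excess of queue `0` over queue `1` is `O(ε)`. -/
theorem integral_excess_le (hMW : IsMaxWeight pooledSchedules rule)
    (hA : ∀ a ∈ arr.support, ∀ i, a i ≤ A)
    (hmean : ∀ i, ∫ a, (a i : ℝ) ∂arr.toMeasure = 1 - ε)
    (hp : p.bind (step arr rule) = p) (ht : Integrable total p.toMeasure) :
    ∫ q, excess q ∂p.toMeasure ≤ (1 + (A + 2 : ℝ) ^ 2) * ε := by
  have he := integrable_excess ht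
  let V : Vec2 → ℝ := fun q => excess q ^ 2 - (A + 2) * excess q
  -- The second moment of the excess is not available, but increments of `V` grow only linearly in
  -- it.
  have hV : Integrable (fun ω => V (nextState ω) - V ω.1.1) (slotLaw p arr rule) := by
    refine Integrable.mono' (((integrable_queue he).const_mul (4 * (A + 2 : ℝ))).add
      (integrable_const (6 * (A + 2 : ℝ) ^ 2))) .of_discrete ?_
    filter_upwards [ae_isSlot (.inl rfl) hMW hA] with ω hω
    have h1 := hω.abs_excess_nextState_sub_le
    have h2 := excess_nonneg (nextState ω)
    have h3 := excess_nonneg ω.1.1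
    have hfac : V (nextState ω) - V ω.1.1 = (excess (nextState ω) - excess ω.1.1) *
        (excess (nextState ω) + excess ω.1.1 - (A + 2)) := by
      simp only [V]
      ring
    have hA0 : (0 : ℝ) ≤ A := Nat.cast_nonneg _
    have h4 : |excess (nextState ω) + excess ω.1.1 - (A + 2)| ≤
        2 * excess ω.1.1 + 3 * (A + 2) := by
      have := abs_le.1 h1
      rw [abs_le]
      constructor <;> linarith
    rw [Real.norm_eq_abs, hfac, abs_mul]
    refine (mul_le_mul h1 h4 (abs_nonneg _) (by positivity)).trans (le_of_eq ?_)
    simp only [Pi.add_apply]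
    ring
  have hz := integral_nextState_sub hp V hV
  have h0 := integral_queue_mul_arrival_sub_one (rule := rule) hA hmean he 0
  have h1 := integral_queue_mul_arrival_sub_one (rule := rule) hA hmean he 1
  have i1 := (h0.1.sub h1.1).const_mul 2
  have i2 := (integrable_queue (arr := arr) (rule := rule) he).const_mul 4
  have i3 := ((integrable_const (μ := slotLaw p arr rule) (1 : ℝ)).sub
    (integrable_service (.inl rfl) hMW hA 1)).const_mul (4 + 2 * (A + 2 : ℝ) ^ 2)
  have hle := integral_mono_ae hV ((i1.sub i2).add i3) (by
    filter_upwards [ae_isSlot (.inl rfl) hMW hA, ae_service_of_pooled hMW] with ω hω hpool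
    exact hω.excess_drift_le hpool)
  rw [hz, integral_add' (i1.sub i2) i3, integral_sub' i1 i2, integral_const_mul,
    integral_sub' h0.1 h1.1, h0.2, h1.2, integral_const_mul, integral_const_mul,
    integral_queue] at hle
  have hid := mul_le_mul_of_nonneg_left (integral_idle_le (.inl rfl) hMW hA hmean hp)
    (show (0 : ℝ) ≤ 4 + 2 * (A + 2 : ℝ) ^ 2 by positivity)
  have hε : 0 ≤ ε := by
    refine le_trans ?_ (integral_idle_le (.inl rfl) hMW hA hmean hp)
    refine integral_nonneg_of_ae ?_
    filter_upwards [ae_isSlot (.inl rfl) hMW hA] with ω hω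
    simpa using hω.service_one_le
  -- The arrival terms cancel as both means equal `1 - ε`. What remains is the bound `(1 + (A + 2)²
  -- / 2) ε`, weakened here using `ε ≥ 0`.
  have hx := mul_nonneg (sq_nonneg (A + 2 : ℝ)) hε
  simp only [Pi.sub_apply] at hle
  linarith

theorem integrable_weightGain (hS : S = pooledSchedules ∨ S = singleSchedules)
    (hMW : IsMaxWeight S rule) (hA : ∀ a ∈ arr.support, ∀ i, a i ≤ A)
    (ht : Integrable total p.toMeasure) : Integrable weightGain (slotLaw p arr rule) := by
  refine (integrable_queue (integrable_excess ht)).mono' .of_discrete ?_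
  filter_upwards [ae_isSlot hS hMW hA] with ω hω
  rw [Real.norm_of_nonneg hω.weightGain_nonneg]
  exact hω.weightGain_le_excess

/-- With pooling this is state-space collapse; without it the gain is zero. -/
theorem integral_weightGain_le (hS : S = pooledSchedules ∨ S = singleSchedules)
    (hMW : IsMaxWeight S rule) (hA : ∀ a ∈ arr.support, ∀ i, a i ≤ A)
    (hmean : ∀ i, ∫ a, (a i : ℝ) ∂arr.toMeasure = 1 - ε) (hε : 0 < ε)
    (hp : p.bind (step arr rule) = p) (ht : Integrable total p.toMeasure) :
    ∫ ω, weightGain ω ∂slotLaw p arr rule ≤ (1 + (A + 2 : ℝ) ^ 2) * ε := by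
  have hint := integrable_weightGain hS hMW hA ht
  rcases hS with rfl | rfl
  · refine le_trans ?_ (integral_excess_le hMW hA hmean hp ht)
    rw [← integral_queue (arr := arr) (rule := rule)]
    refine integral_mono_ae hint (integrable_queue (integrable_excess ht)) ?_
    filter_upwards [ae_isSlot (.inl rfl) hMW hA] with ω hω using hω.weightGain_le_excess
  · refine (integral_nonpos_of_ae ?_).trans (by positivity)
    filter_upwards [ae_weight_le_of_single hMW] with ω hω
    have : (ω.1.1 0 : ℝ) * ω.1.2 0 + ω.1.1 1 * ω.1.2 1 ≤ ω.1.1 0 + ω.1.1 1 := by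
      exact_mod_cast hω
    simp only [weightGain, Pi.zero_apply]
    linarith

theorem integral_arrival_sub_one_sq (hA : ∀ a ∈ arr.support, ∀ i, a i ≤ A)
    (hmean : ∀ i, ∫ a, (a i : ℝ) ∂arr.toMeasure = 1 - ε) (i : Fin 2) :
    Integrable (fun a : Vec2 => ((a i : ℝ) - 1) ^ 2) arr.toMeasure ∧
    ∫ a : Vec2, ((a i : ℝ) - 1) ^ 2 ∂arr.toMeasure =
      variance (fun a : Vec2 => (a i : ℝ)) arr.toMeasure + ε ^ 2 := by
  have hL : MemLp (fun a : Vec2 => (a i : ℝ)) 2 arr.toMeasure := by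
    refine MemLp.of_bound .of_discrete (A : ℝ) ?_
    rw [ae_iff, PMF.toMeasure_apply_eq_zero_iff _ .of_discrete, Set.disjoint_left]
    intro a ha
    simpa using hA a ha i
  have h1 := integrable_arrival hA i
  have h2 := hL.integrable_sq
  have heq : (fun a : Vec2 => ((a i : ℝ) - 1) ^ 2) =
      fun a => (a i : ℝ) ^ 2 - 2 * (a i : ℝ) + 1 := by
    funext a
    ring
  have i1 := integrable_fun_sub h2 (h1.const_mul 2)
  rw [heq]
  refine ⟨i1.add (integrable_const 1), ?_⟩
  rw [integral_add i1 (integrable_const 1), integral_sub h2 (h1.const_mul 2), integral_const_mul,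
    hmean, integral_const, probReal_univ, one_smul, variance_eq_sub hL, hmean]
  simp only [Pi.pow_apply]
  ring

/-- The mean queue length in steady state, up to an error of order `ε`. -/
theorem abs_total_sub_variance_le (hS : S = pooledSchedules ∨ S = singleSchedules)
    (hMW : IsMaxWeight S rule) (hA : ∀ a ∈ arr.support, ∀ i, a i ≤ A)
    (hmean : ∀ i, ∫ a, (a i : ℝ) ∂arr.toMeasure = 1 - ε) (hε : 0 < ε)
    (hp : p.bind (step arr rule) = p) (ht : Integrable total p.toMeasure) :
    |2 * (ε * ∫ q, total q ∂p.toMeasure) -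
      (variance (fun a : Vec2 => (a 0 : ℝ)) arr.toMeasure +
        variance (fun a : Vec2 => (a 1 : ℝ)) arr.toMeasure)| ≤
      2 * ε ^ 2 + 2 * ((1 + (A + 2 : ℝ) ^ 2) * ε) + (2 * A + 3) * (4 * ε) := by
  have hq (i : Fin 2) : Integrable (fun q : Vec2 => (q i : ℝ)) p.toMeasure :=
    ht.mono' .of_discrete (ae_of_all _ fun q => by
      rw [Real.norm_natCast]
      unfold total
      fin_cases i <;> simp)
  have hG := integrable_weightGain (rule := rule) hS hMW hA ht
  have hGle := integral_weightGain_le hS hMW hA hmean hε hp ht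
  have hG0 : 0 ≤ ∫ ω, weightGain ω ∂slotLaw p arr rule := by
    refine integral_nonneg_of_ae ?_
    filter_upwards [ae_isSlot hS hMW hA] with ω hω using hω.weightGain_nonneg
  obtain ⟨hsl, hslle⟩ := integral_slack_le hS hMW hA hmean hp
  have hRb : ∀ᵐ ω ∂slotLaw p arr rule, ‖remainder ω‖ ≤ (2 * A + 3) *
      ((2 - (ω.1.2 0 : ℝ) - ω.1.2 1) + 2 * (1 - (ω.1.2 1 : ℝ)) +
        slotUnused ω 0 + slotUnused ω 1) := by
    filter_upwards [ae_isSlot hS hMW hA] with ω hω using hω.abs_remainder_le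
  have hR : Integrable remainder (slotLaw p arr rule) :=
    (hsl.const_mul (2 * A + 3 : ℝ)).mono' .of_discrete hRb
  have hRle : |∫ ω, remainder ω ∂slotLaw p arr rule| ≤ (2 * A + 3) * (4 * ε) := by
    refine (norm_integral_le_of_norm_le (hsl.const_mul (2 * A + 3 : ℝ)) hRb).trans ?_
    rw [integral_const_mul]
    gcongr
  have h0 := integral_queue_mul_arrival_sub_one (rule := rule) hA hmean (hq 0) 0
  have h1 := integral_queue_mul_arrival_sub_one (rule := rule) hA hmean (hq 1) 1
  have v0 := integral_arrival_sub_one_sq hA hmean 0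
  have v1 := integral_arrival_sub_one_sq hA hmean 1
  have harr {g : Vec2 → ℝ} (hg : Integrable g arr.toMeasure) :
      Integrable (fun ω => g ω.2) (slotLaw p arr rule) := by
    rw [← map_arrival_slotLaw (p := p) (rule := rule)] at hg
    exact hg.comp_measurable .of_discrete
  have i1 := (h0.1.fun_add h1.1).const_mul 2
  have i2 := hG.const_mul 2
  have i3 := (harr v0.1).fun_add (harr v1.1)
  have hV : Integrable (fun ω => sqNorm (nextState ω) - sqNorm ω.1.1) (slotLaw p arr rule) := by
    simp only [sqNorm_nextState_sub_eq]
    exact ((i1.sub i2).add i3).add hR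
  have hz := integral_nextState_sub hp sqNorm hV
  simp only [sqNorm_nextState_sub_eq] at hz
  rw [integral_add ((integrable_fun_sub i1 i2).fun_add i3) hR,
    integral_add (integrable_fun_sub i1 i2) i3, integral_sub i1 i2, integral_const_mul, integral_const_mul, integral_add h0.1 h1.1, h0.2, h1.2,
    integral_add (harr v0.1) (harr v1.1), integral_arrival (fun a => ((a 0 : ℝ) - 1) ^ 2),
    integral_arrival (fun a => ((a 1 : ℝ) - 1) ^ 2), v0.2, v1.2] at hz
  have htot : ∫ q, total q ∂p.toMeasure =
      ∫ q, (q 0 : ℝ) ∂p.toMeasure + ∫ q, (q 1 : ℝ) ∂p.toMeasure := integral_add (hq 0) (hq 1)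
  have hRle' := abs_le.1 hRle
  have hε2 := sq_nonneg ε
  have hKε : 0 ≤ (1 + (A + 2 : ℝ) ^ 2) * ε := by positivity
  -- The three errors are the squared biases of the means from `1`, twice the gain, and the
  -- remainder.
  rw [htot, abs_le]
  constructor <;> linarith

end HeavyTraffic

end NSystem

/-! ### The heavy-traffic limit -/

theorem corollary5
    (S : Set Vec2) (hS : S = NSystem.pooledSchedules ∨ S = NSystem.singleSchedules)
    (arr : ℝ → PMF Vec2) (rule : ℝ → Vec2 → PMF Vec2)
    (hMW : ∀ ε ∈ Ioo (0 : ℝ) 1, NSystem.IsMaxWeight S (rule ε))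
    (Amax : ℕ)
    (hbdd : ∀ ε ∈ Ioo (0 : ℝ) 1, ∀ a ∈ (arr ε).support, ∀ i, a i ≤ Amax)
    (hmean : ∀ ε ∈ Ioo (0 : ℝ) 1, ∀ i, ∫ a, (a i : ℝ) ∂(arr ε).toMeasure = 1 - ε)
    (σ : Fin 2 → ℝ)
    (hvar : ∀ i, Tendsto (fun ε => variance (fun a : Vec2 => (a i : ℝ)) (arr ε).toMeasure)
      (𝓝[>] (0 : ℝ)) (𝓝 (σ i ^ 2))) :
    (∀ ε ∈ Ioo (0 : ℝ) 1, ∃ π : PMF Vec2,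
      NSystem.IsSteadyState (NSystem.step (arr ε) (rule ε)) π) ∧
    ∀ qbar : ℝ → PMF Vec2,
      (∀ ε ∈ Ioo (0 : ℝ) 1,
        NSystem.IsSteadyState (NSystem.step (arr ε) (rule ε)) (qbar ε)) →
      (∀ ε ∈ Ioo (0 : ℝ) 1,
        Integrable (fun q : Vec2 => (q 0 : ℝ) + (q 1 : ℝ)) (qbar ε).toMeasure) ∧
      Tendsto (fun ε => ε * ∫ q, ((q 0 : ℝ) + (q 1 : ℝ)) ∂(qbar ε).toMeasure)
        (𝓝[>] (0 : ℝ)) (𝓝 ((σ 0 ^ 2 + σ 1 ^ 2) / 2)) := by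
  refine ⟨fun ε hε => ?_, fun qbar hq => ?_⟩
  · obtain ⟨π, hπ⟩ :=
      NSystem.exists_stationary hS (hMW ε hε) (hbdd ε hε) (hmean ε hε) hε.1
    exact ⟨π, NSystem.isSteadyState_of_bind_eq hπ⟩
  have hint : ∀ ε ∈ Ioo (0 : ℝ) 1, Integrable NSystem.total (qbar ε).toMeasure := fun ε hε =>
    NSystem.integrable_total_of_stationary hS (hMW ε hε) (hbdd ε hε) (hmean ε hε) hε.1
      (hq ε hε).bind_eq
  refine ⟨hint, ?_⟩
  -- The error bound vanishes because `Amax` does not depend on `ε`.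
  have hsmall : Tendsto (fun ε : ℝ => 2 * ε ^ 2 + 2 * ((1 + (Amax + 2 : ℝ) ^ 2) * ε) +
      (2 * Amax + 3) * (4 * ε)) (𝓝[>] (0 : ℝ)) (𝓝 0) := by
    refine Tendsto.mono_left ?_ nhdsWithin_le_nhds
    exact (Continuous.tendsto' (by fun_prop) _ _ (by simp))
  have hdiff : Tendsto (fun ε => 2 * (ε * ∫ q, NSystem.total q ∂(qbar ε).toMeasure) -
      (variance (fun a : Vec2 => (a 0 : ℝ)) (arr ε).toMeasure +
        variance (fun a : Vec2 => (a 1 : ℝ)) (arr ε).toMeasure)) (𝓝[>] (0 : ℝ)) (𝓝 0) :=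
    squeeze_zero_norm' (by
    filter_upwards [Ioo_mem_nhdsGT (zero_lt_one (α := ℝ))] with ε hε
    exact NSystem.abs_total_sub_variance_le hS (hMW ε hε) (hbdd ε hε) (hmean ε hε) hε.1
      (hq ε hε).bind_eq (hint ε hε)) hsmall
  have h := (hdiff.add ((hvar 0).add (hvar 1))).div_const 2
  rw [zero_add] at h
  refine h.congr fun ε => ?_
  rw [sub_add_cancel, mul_div_cancel_left₀ _ two_ne_zero]
  rfl
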